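/- Rental harmony with a secretive roommate. Let $n\ge 1$, let $R>0$ be the total rent of an $n$-bedroom apartment, and let $\varepsilon>0$ be an error margin (one cent, say). A division of the rent is a vector $p\in\mathbb{R}^n$ with $p_r\ge 0$ for every room $r$ and $\sum_r p_r=R$. The preferences of a tenant are given by a set $A(p)\subseteq\{1,\dots,n\}$ of acceptable (most preferred) rooms for each division $p$ of the rent, subject to these conditions: (1) $A(p)\neq\emptyset$ for every $p$; (2) a free room is preferred to a non-free room (if $p_r=0<p_s$ and $s\in A(p)$, then $r\in A(p)$) and the tenant is indifferent among free rooms (if $p_r=p_s=0$, then $r\in A(p)$ if and only if $s\in A(p)$). (3) Tenants do not care about errors of at most $\varepsilon$: a tenant is content with room $r$ at the prices $p$ if $r\in A(q)$ for some division $q$ of the rent with $|q_s-p_s|\le\varepsilon$ for all rooms $s$. Then the preferences of $n-1$ of the $n$ roommates suffice to find an envy-free division of the rent, and finitely many questions suffice: there is a finite set $Q$ of divisions of the rent, depending only on $n$, $R$ and $\varepsilon$, such that for all preferences $A_1,\dots,A_{n-1}$ satisfying (1) and (2), the sets $A_i(q)$ with $1\le i\le n-1$ and $q\in Q$ determine a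 division $p$ of the rent and, for each room $c$, a bijection $\sigma_c$ from the $n-1$ roommates to the rooms other than $c$, such that for every $c$ and every $i$ roommate $i$ is content with room $\sigma_c(i)$ at the prices $p$. In particular, whichever room $c$ the $n$-th roommate picks at the prices $p$, the remaining $n-1$ rooms can be assigned to the other roommates without envy. -/

import Mathlib

/-- A division of the total rent `R` among `n` rooms: nonnegative prices, one for each room,
that add up to `R`. -/
abbrev RentDivision (n : ℕ) (R : ℝ) : Type :=
  {p : Fin n → ℝ // (∀ r, 0 ≤ p r) ∧ ∑ r, p r = R}

/-- The subjective preferences of a tenant: for each division `p` of the rent, the set of rooms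
that the tenant prefers (finds acceptable) at the prices `p`, that is, the rooms for which no
other room is strictly preferred at these prices. Several rooms may be preferred at once. -/
abbrev Preferences (n : ℕ) (R : ℝ) : Type :=
  RentDivision n R → Set (Fin n)

/-- The conditions imposed on the preferences of a tenant. (The tolerance for small errors
in the prices is the notion `ContentWithin` below.) -/
structure IsAdmissible {n : ℕ} {R : ℝ} (A : Preferences n R) : Prop where
  /-- In any division of the rent, the tenant finds at least one room acceptable. -/
  acceptable : ∀ p, ∃ r, r ∈ A p
  /-- A free room is preferred to a non-free room: a non-free room can be acceptable only if every
  free room is. (This holds in particular if no non-free room is ever acceptable while some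
  room is free.) -/
  free_over_nonfree : ∀ (p : RentDivision n R) (r s : Fin n),
    p.1 r = 0 → 0 < p.1 s → s ∈ A p → r ∈ A p
  /-- The tenant is indifferent among free rooms. -/
  indifferent : ∀ (p : RentDivision n R) (r s : Fin n),
    p.1 r = 0 → p.1 s = 0 → (r ∈ A p ↔ s ∈ A p)

/-- A tenant with preferences `A` who does not care about errors of at most `ε` in the price of a
room is content with room `r` at the prices `p` (does not envy the tenant of another
room): the tenant prefers `r` at some division of the rent within `ε` of `p`. -/
def ContentWithin {n : ℕ} {R : ℝ} (ε : ℝ) (A : Preferences n R) (p : RentDivision n R)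
    (r : Fin n) : Prop :=
  ∃ q : RentDivision n R, (∀ s, |q.1 s - p.1 s| ≤ ε) ∧ r ∈ A q

/-- The answers of `n - 1` tenants when they are asked at each of the finitely many divisions of the
rent in `Q` which rooms they prefer. -/
abbrev Survey {n : ℕ} {R : ℝ} (Q : Finset (RentDivision n R)) : Type :=
  Fin (n - 1) → Q → Set (Fin n)

/-- The answers to the survey `Q` of tenants with the preferences `A`. -/
def surveyOf {n : ℕ} {R : ℝ} (Q : Finset (RentDivision n R))
    (A : Fin (n - 1) → Preferences n R) : Survey Q :=
  fun i q => A i q.1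

open Finset Filter Topology

/-! A finite cover of the compact rent simplex fixes `Q`: `exists_weights` gives continuous weights
`w v`, positive only near `v` and zero wherever a room that costs something at `v` is free. By
admissibility each tenant can label each `v ∈ Q` with a non-free room `r` such that `r + 1` is
acceptable (`IsAdmissible.exists_nonfree`); the cyclic shift turns the preference for free rooms
into Sperner's boundary condition.

At a division `p`, adding up the weights by label gives a matrix of `n - 1` tenants by `n` rooms
whose rows all sum to `W p`. A KKM argument (`exists_mem_iInter_of_facets_subset`) yields a `p`
where no column sum exceeds `(n - 1) / n * W p`. Column sums below row sums leave room in Hall's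
condition for deleting any one column (`exists_injective_avoiding`), namely the room taken by the
secretive roommate. A positive entry of the matrix comes from a point of `Q` near `p`, which gives
contentment.

KKM is derived without triangulations, from Scarf's lemma on dominant sets
(`exists_isDominant_colorful`) applied to the coordinate orders on an integer grid. -/

/-- A map from a finite set onto a set with one element less stays onto after the removal of
exactly two of its elements. -/
theorem card_filter_image_erase_eq_two {α β : Type*} [DecidableEq α] [DecidableEq β]
    {s : Finset α} {t : Finset β} {f : α → β} (h : s.image f = t) (hc : #s = #t + 1) :
    ∃ a ∈ s, ∃ b ∈ s, a ≠ b ∧ f a = f b ∧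
      (∀ i ∈ s, ∀ j ∈ s, f i = f j → i ≠ j → (i = a ∧ j = b) ∨ (i = b ∧ j = a)) ∧
      {d ∈ s | (s.erase d).image f = t} = {a, b} := by
  subst h
  obtain ⟨a, ha, b, hb, hab, hf⟩ :=
    exists_ne_map_eq_of_card_lt_of_maps_to (by omega : #(s.image f) < #s)
      (fun x hx => mem_image_of_mem f hx)
  have key : ∀ a ∈ s, ∀ b ∈ s, a ≠ b → f a = f b → (s.erase a).image f = s.image f := by
    intro a ha b hb hab hf
    ext y
    simp only [mem_image, mem_erase]
    constructor
    · rintro ⟨x, hx, rfl⟩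
      exact ⟨x, hx.2, rfl⟩
    · rintro ⟨x, hx, rfl⟩
      by_cases hxa : x = a
      · exact ⟨b, ⟨hab.symm, hb⟩, by rw [hxa, hf]⟩
      · exact ⟨x, ⟨hxa, hx⟩, rfl⟩
  -- If removing `d` keeps the image, domain and image become equinumerous and `f` is injective on
  -- the rest. So `d` belongs to every pair that `f` identifies.
  have inj : ∀ d ∈ s, (s.erase d).image f = s.image f →
      Set.InjOn f (s.erase d : Finset α) := by
    intro d hd hi
    apply card_image_iff.mp
    rw [hi, card_erase_of_mem hd]
    omega
  have two : ∀ d ∈ s, (s.erase d).image f = s.image f →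
      ∀ i ∈ s, ∀ j ∈ s, f i = f j → i ≠ j → d = i ∨ d = j := by
    intro d hd hi i hi' j hj hij hne
    by_contra! hcon
    exact hne (inj d hd hi (by simp [hi', hcon.1.symm]) (by simp [hj, hcon.2.symm]) hij)
  have ka := key a ha b hb hab hf
  have kb := key b hb a ha hab.symm hf.symm
  refine ⟨a, ha, b, hb, hab, hf, ?_, ?_⟩
  · intro i hi j hj hij hne
    have h1 := two a ha ka i hi j hj hij hne
    have h2 := two b hb kb i hi j hj hij hne
    grind
  · ext d
    simp only [mem_filter, mem_insert, mem_singleton]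
    constructor
    · rintro ⟨hd, hi⟩
      exact two d hd hi a ha b hb hf hab
    · rintro (rfl | rfl)
      · exact ⟨ha, ka⟩
      · exact ⟨hb, kb⟩

/-! ### Scarf's lemma on dominant sets. -/

section Dominant

variable {I V α : Type*} [LinearOrder α]

/-- A set of points is dominant for a family of orders if no point lies strictly above its
minimum in all of the orders. -/
def IsDominant (h : I → V → α) (X : Finset V) : Prop :=
  ∀ y, ∃ i, ∀ x ∈ X, h i y ≤ h i x

theorem IsDominant.mono {h : I → V → α} {X Y : Finset V} (hX : IsDominant h X) (hYX : Y ⊆ X) :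
    IsDominant h Y :=
  fun y => (hX y).imp fun _ hi x hx => hi x (hYX hx)

/-- The points above the minimum of `X` in all orders but the `i`-th one. -/
def aboveExcept (h : I → V → α) (X : Finset V) (i : I) : Set V :=
  {y | ∀ j, j ≠ i → ∃ x ∈ X, h j x < h j y}

/-- `x` is the `i`-th largest among the points above the minimum of `X` in all the other orders. -/
def IsTopExcept (h : I → V → α) (X : Finset V) (i : I) (x : V) : Prop :=
  x ∈ aboveExcept h X i ∧ ∀ y ∈ aboveExcept h X i, h i y ≤ h i x

/-- The dominant sets that extend `X` by one point correspond to the points that extend it. -/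
theorem card_extensions_eq [Fintype V] [DecidableEq V] (h : I → V → α) (X : Finset V)
    [DecidablePred (IsDominant h)] (k : ℕ) (hk : #X + 1 = k) :
    #{Y ∈ {Y ∈ powersetCard k (univ : Finset V) | IsDominant h Y} | X ⊆ Y} =
      #{x | x ∉ X ∧ IsDominant h (insert x X)} := by
  symm
  apply card_bij (fun x _ => insert x X)
  · intro x hx
    simp only [mem_filter, mem_univ, true_and] at hx
    simp [hx.2, mem_powersetCard, card_insert_of_notMem hx.1, hk]
  · intro x hx y hy hxy
    simp only [mem_filter, mem_univ, true_and] at hx hy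
    have : x ∈ insert y X := by
      rw [← hxy]
      exact mem_insert_self _ _
    exact (mem_insert.1 this).resolve_right hx.1
  · intro Y hY
    simp only [mem_filter, mem_powersetCard, subset_univ, true_and] at hY
    obtain ⟨⟨hYc, hYd⟩, hXY⟩ := hY
    have hsd : #(Y \ X) = 1 := by
      rw [card_sdiff_of_subset hXY]
      omega
    obtain ⟨x, hx⟩ := card_eq_one.1 hsd
    have hxY : x ∈ Y \ X := hx ▸ mem_singleton_self x
    have hins : insert x X = Y := by
      rw [insert_eq, ← hx, sdiff_union_of_subset hXY]
    refine ⟨x, ?_, hins⟩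
    simp [(mem_sdiff.1 hxY).2, hins, hYd]

variable [Fintype I] [DecidableEq I] [DecidableEq V]

/-- A dominant set with one point less than there are orders can be extended in one step to a
dominant set only by two candidates. -/
theorem IsDominant.exists_extensions {h : I → V → α} (hinj : ∀ i, Function.Injective (h i))
    {X : Finset V} (hX : IsDominant h X) (hne : X.Nonempty) (hcard : #X + 1 = Fintype.card I) :
    ∃ a b : I, a ≠ b ∧
      (∀ x, (x ∉ X ∧ IsDominant h (insert x X)) ↔ (IsTopExcept h X a x ∨ IsTopExcept h X b x)) ∧
      ∀ x, ¬ (IsTopExcept h X a x ∧ IsTopExcept h X b x) := by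
  choose m hm hmin using fun i => X.exists_min_image (h i) hne
  -- Dominance tested at a point of `X` makes it the minimum in some order. With one order more than
  -- points, exactly one pair of orders `a`, `b` shares its minimum.
  have him : (univ : Finset I).image m = X := by
    ext y
    simp only [mem_image, mem_univ, true_and]
    constructor
    · rintro ⟨i, rfl⟩
      exact hm i
    · intro hy
      obtain ⟨i, hi⟩ := hX y
      exact ⟨i, hinj i (le_antisymm (hmin i y hy) (hi _ (hm i)))⟩
  obtain ⟨a, -, b, -, hab, hmab, huniq, -⟩ :=
    card_filter_image_erase_eq_two him (by rw [card_univ, hcard])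
  have habove : ∀ i y, y ∈ aboveExcept h X i ↔ ∀ j, j ≠ i → h j (m j) < h j y := by
    intro i y
    refine forall₂_congr fun j _ => ⟨?_, fun hj => ⟨m j, hm j, hj⟩⟩
    rintro ⟨x, hx, hxy⟩
    exact (hmin j x hx).trans_lt hxy
  have hat : ∀ i y k, y ∈ aboveExcept h X i → h k y ≤ h k (m k) → k = i := by
    intro i y k hy hk
    by_contra hki
    exact absurd ((habove i y).1 hy k hki) (not_lt.2 hk)
  have hsurj : ∀ x ∈ X, ∃ j, m j = x := fun x hx => by
    rw [← him] at hx
    simpa using hx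
  have back : ∀ i, i = a ∨ i = b → ∀ x, IsTopExcept h X i x →
      x ∉ X ∧ IsDominant h (insert x X) := by
    rintro i hi x ⟨hx, htop⟩
    constructor
    · intro hxX
      obtain ⟨j, rfl⟩ := hsurj x hxX
      have hji := hat i _ j hx le_rfl
      subst hji
      rcases hi with rfl | rfl
      · exact hab (hat j _ b hx (by rw [hmab])).symm
      · exact hab (hat j _ a hx (by rw [hmab]))
    · intro y
      by_cases hy : y ∈ aboveExcept h X i
      · obtain ⟨k, hk⟩ := hX y
        obtain rfl := hat i y k hy (hk _ (hm k))
        refine ⟨k, fun z hz => ?_⟩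
        rcases mem_insert.1 hz with rfl | hz
        · exact htop y hy
        · exact hk z hz
      · rw [habove] at hy
        push Not at hy
        obtain ⟨j, hji, hj⟩ := hy
        refine ⟨j, fun z hz => ?_⟩
        rcases mem_insert.1 hz with rfl | hz
        · exact hj.trans ((habove i _).1 hx j hji).le
        · exact hj.trans (hmin j z hz)
  refine ⟨a, b, hab, fun x => ⟨?_, ?_⟩, ?_⟩
  · rintro ⟨hxX, hdom⟩
    have hne' : ∀ j, x ≠ m j := fun j hj => hxX (hj ▸ hm j)
    obtain ⟨i, hi⟩ := hdom x
    -- Every old point must stay the minimum in some order. As `x` takes over the minimum in order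
    -- `i`, the old minimum there needs a second order, so `i` is `a` or `b`.
    have hpos : ∀ j, ∃ k, m k = m j ∧ h k (m j) < h k x := by
      intro j
      obtain ⟨k, hk⟩ := hdom (m j)
      refine ⟨k, hinj k (le_antisymm (hmin k _ (hm j))
        (hk _ (mem_insert_of_mem (hm k)))), lt_of_le_of_ne (hk x (mem_insert_self _ _)) ?_⟩
      exact fun he => hne' j (hinj k he.symm)
    have hxm : ∀ j, h i x ≤ h i (m j) := fun j => hi _ (mem_insert_of_mem (hm j))
    have hiab : i = a ∨ i = b := by
      obtain ⟨k, hk, hlt⟩ := hpos i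
      have hki : k ≠ i := by
        rintro rfl
        exact absurd hlt (not_lt.2 (hxm k))
      rcases huniq k (mem_univ _) i (mem_univ _) hk hki with h | h
      · exact Or.inr h.2
      · exact Or.inl h.2
    have htop : IsTopExcept h X i x := by
      constructor
      · rw [habove]
        intro j hji
        obtain ⟨k, hk, hlt⟩ := hpos j
        by_cases hkj : k = j
        · rwa [hkj] at hlt
        · exfalso
          have hki : k = i := by
            rcases huniq k (mem_univ _) j (mem_univ _) hk hkj with h | h <;>
              rcases hiab with h' | h' <;> grind
          rw [hki] at hlt
          exact absurd hlt (not_lt.2 (hxm j))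
      · intro y hy
        obtain ⟨k, hk⟩ := hdom y
        obtain rfl := hat i y k hy (hk _ (mem_insert_of_mem (hm k)))
        exact hk x (mem_insert_self _ _)
    rcases hiab with rfl | rfl
    · exact Or.inl htop
    · exact Or.inr htop
  · rintro (hx | hx)
    · exact back a (Or.inl rfl) x hx
    · exact back b (Or.inr rfl) x hx
  · rintro x ⟨⟨hxa, -⟩, hxb, -⟩
    obtain ⟨k, hk⟩ := hX x
    exact hab ((hat a x k hxa (hk _ (hm k))).symm.trans (hat b x k hxb (hk _ (hm k))))

/-- A colouring that gives each corner its own colour has a dominant set of all colours. -/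
theorem exists_isDominant_colorful [Fintype V] [Nontrivial I] {h : I → V → α}
    (hinj : ∀ i, Function.Injective (h i)) (t : I → V) (c : V → I) (hct : ∀ i, c (t i) = i)
    (hlow : ∀ i x, h i (t i) ≤ h i x)
    (hhigh : ∀ i j x, j ≠ i → x ∉ Set.range t → h i x < h i (t j))
    (hne : ∃ x, x ∉ Set.range t) :
    ∃ X, IsDominant h X ∧ ∀ i, ∃ x ∈ X, c x = i := by
  classical
  by_contra! hno
  obtain ⟨i₀⟩ : Nonempty I := inferInstance
  have htinj : Function.Injective t := fun i j hij => by rw [← hct i, hij, hct]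
  have hlow' : ∀ i x, h i x ≤ h i (t i) → x = t i :=
    fun i x hx => hinj i (le_antisymm hx (hlow i x))
  set n := Fintype.card I with hn
  have hn2 : 1 < n := Fintype.one_lt_card
  -- Parity count of incidences between doors and rooms. Without a fully coloured room, every room
  -- has no door or two; every door lies in two rooms, except the door of corners `X₀`, which lies
  -- in one.
  set rooms : Finset (Finset V) := {X ∈ powersetCard n (univ : Finset V) | IsDominant h X}
    with hrooms
  set doors : Finset (Finset V) := {X ∈ powersetCard (n - 1) (univ : Finset V) |
    IsDominant h X ∧ X.image c = univ.erase i₀} with hdoors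
  have herase : #((univ : Finset I).erase i₀) + 1 = n := by
    rw [card_erase_of_mem (mem_univ _), card_univ]
    omega
  have hdoor : ∀ X ∈ doors, #X + 1 = n ∧ IsDominant h X ∧ X.image c = univ.erase i₀ := by
    intro X hX
    simp only [hdoors, mem_filter, mem_powersetCard, subset_univ, true_and] at hX
    exact ⟨by omega, hX.2⟩
  have hroom : ∀ X ∈ rooms, #X = n ∧ IsDominant h X := by
    intro X hX
    simpa only [hrooms, mem_filter, mem_powersetCard, subset_univ, true_and] using hX
  have hEvenRooms : ∀ Y ∈ rooms, Even #(doors.bipartiteBelow (· ⊆ ·) Y) := by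
    intro Y hY
    obtain ⟨hYc, hYd⟩ := hroom Y hY
    by_cases hemp : doors.bipartiteBelow (· ⊆ ·) Y = ∅
    · simp [hemp]
    obtain ⟨X, hX⟩ := nonempty_iff_ne_empty.2 hemp
    obtain ⟨hXd, hXY⟩ := (mem_bipartiteBelow _).1 hX
    have him : Y.image c = univ.erase i₀ := by
      obtain ⟨i, hi⟩ := hno Y hYd
      have hsub : univ.erase i₀ ⊆ Y.image c := by
        rw [← (hdoor X hXd).2.2]
        exact image_subset_image hXY
      refine (eq_of_subset_of_card_le hsub ?_).symm
      have hlt : #(Y.image c) < #(univ : Finset I) := by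
        apply card_lt_card
        refine ⟨subset_univ _, fun hu => ?_⟩
        obtain ⟨x, hx, hxi⟩ := mem_image.1 (hu (mem_univ i))
        exact hi x hx hxi
      rw [card_univ] at hlt
      omega
    obtain ⟨a, -, b, -, hab, -, -, hfil⟩ := card_filter_image_erase_eq_two him (by omega)
    have : #(doors.bipartiteBelow (· ⊆ ·) Y) =
        #{d ∈ Y | (Y.erase d).image c = univ.erase i₀} := by
      symm
      apply card_bij (fun x _ => Y.erase x)
      · intro x hx
        rw [mem_filter] at hx
        rw [mem_bipartiteBelow]
        refine ⟨?_, erase_subset _ _⟩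
        simp only [hdoors, mem_filter, mem_powersetCard, subset_univ, true_and]
        exact ⟨by rw [card_erase_of_mem hx.1, hYc], hYd.mono (erase_subset _ _), hx.2⟩
      · intro x hx y hy hxy
        exact erase_injOn Y (mem_filter.1 hx).1 (mem_filter.1 hy).1 hxy
      · intro Z hZ
        obtain ⟨hZd, hZY⟩ := (mem_bipartiteBelow _).1 hZ
        obtain ⟨hZc, -, hZi⟩ := hdoor Z hZd
        have hsd : #(Y \ Z) = 1 := by
          rw [card_sdiff_of_subset hZY]
          omega
        obtain ⟨x, hx⟩ := card_eq_one.1 hsd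
        have hxY : x ∈ Y \ Z := hx ▸ mem_singleton_self x
        have hins : Y.erase x = Z := by
          rw [erase_eq, ← hx, Finset.sdiff_sdiff_eq_self hZY]
        refine ⟨x, mem_filter.2 ⟨(mem_sdiff.1 hxY).1, ?_⟩, hins⟩
        rw [hins, hZi]
    rw [this, hfil, card_pair hab]
    exact even_two
  set X₀ : Finset V := (univ.erase i₀).image t with hX₀
  have hmemX₀ : ∀ i, i ≠ i₀ → t i ∈ X₀ := fun i hi =>
    mem_image_of_mem t (mem_erase.2 ⟨hi, mem_univ _⟩)
  have hX₀mem : ∀ x ∈ X₀, ∃ i, i ≠ i₀ ∧ t i = x := by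
    intro x hx
    obtain ⟨i, hi, rfl⟩ := mem_image.1 hx
    exact ⟨i, (mem_erase.1 hi).1, rfl⟩
  have hX₀card : #X₀ + 1 = n := by rw [hX₀, card_image_of_injective _ htinj, herase]
  have hX₀dom : IsDominant h X₀ := by
    intro y
    by_cases hy : y ∈ Set.range t
    · obtain ⟨i, rfl⟩ := hy
      exact ⟨i, fun x _ => hlow i x⟩
    · refine ⟨i₀, fun x hx => ?_⟩
      obtain ⟨i, hi, rfl⟩ := hX₀mem x hx
      exact (hhigh i₀ i y hi hy).le
  have hX₀door : X₀ ∈ doors := by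
    simp only [hdoors, mem_filter, mem_powersetCard, subset_univ, true_and]
    refine ⟨by omega, hX₀dom, ?_⟩
    rw [hX₀, image_image]
    have : c ∘ t = id := funext hct
    rw [this, image_id]
  have hOne : #(rooms.bipartiteAbove (· ⊆ ·) X₀) = 1 := by
    rw [bipartiteAbove, hrooms, card_extensions_eq h X₀ n hX₀card]
    obtain ⟨x, hx, hxmax⟩ := exists_max_image ({x | x ∉ Set.range t} : Finset V) (h i₀)
      (by obtain ⟨x, hx⟩ := hne; exact ⟨x, by simpa using hx⟩)
    have hx : x ∉ Set.range t := by simpa using hx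
    have hxmax : ∀ y, y ∉ Set.range t → h i₀ y ≤ h i₀ x := fun y hy => hxmax y (by simpa using hy)
    rw [card_eq_one]
    refine ⟨x, ?_⟩
    ext y
    simp only [mem_filter, mem_univ, true_and, mem_singleton]
    constructor
    · rintro ⟨hy, hdom⟩
      obtain ⟨j, hj⟩ := hdom x
      have hji : j = i₀ := by
        by_contra hji
        have := hlow' j x (hj _ (mem_insert_of_mem (hmemX₀ j hji)))
        exact hx ⟨j, this.symm⟩
      subst hji
      have hxy := hj y (mem_insert_self _ _)
      have hyr : y ∉ Set.range t := by
        rintro ⟨i, rfl⟩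
        by_cases hij : i = j
        · subst hij
          exact hx ⟨i, (hlow' i x hxy).symm⟩
        · exact hy (hmemX₀ i hij)
      exact hinj j (le_antisymm (hxmax y hyr) hxy)
    · rintro rfl
      constructor
      · intro hy
        obtain ⟨i, -, hi⟩ := hX₀mem y hy
        exact hx ⟨i, hi⟩
      · intro z
        by_cases hz : z ∈ Set.range t
        · obtain ⟨i, rfl⟩ := hz
          exact ⟨i, fun x _ => hlow i x⟩
        · refine ⟨i₀, fun w hw => ?_⟩
          rcases mem_insert.1 hw with rfl | hw
          · exact hxmax z hz
          · obtain ⟨i, hi, rfl⟩ := hX₀mem w hw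
            exact (hhigh i₀ i z hi hz).le
  have hEvenDoors : ∀ X ∈ doors.erase X₀, Even #(rooms.bipartiteAbove (· ⊆ ·) X) := by
    intro X hX
    obtain ⟨hXne, hXd⟩ := mem_erase.1 hX
    obtain ⟨hXc, hXdom, hXi⟩ := hdoor X hXd
    -- Corners have their own colours, so a door made of corners only would be `X₀`. The non-corner
    -- `z` puts `t i` into `aboveExcept h X i`, so that a top element exists for every `i`.
    have hz : ∃ z ∈ X, z ∉ Set.range t := by
      by_contra! hall
      refine hXne (eq_of_subset_of_card_le (fun z hz => ?_) (by omega))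
      obtain ⟨i, rfl⟩ := hall z hz
      apply hmemX₀
      have := mem_image_of_mem c hz
      rw [hXi, hct] at this
      exact (mem_erase.1 this).1
    obtain ⟨z, hzX, hz⟩ := hz
    have htop : ∀ i, ∃ x, IsTopExcept h X i x := by
      intro i
      obtain ⟨x, hx, hmax⟩ := exists_max_image ({x | x ∈ aboveExcept h X i} : Finset V) (h i)
        ⟨t i, mem_filter.2 ⟨mem_univ _, fun j hji => ⟨z, hzX, hhigh j i z (Ne.symm hji) hz⟩⟩⟩
      exact ⟨x, by simpa using hx, fun y hy => hmax y (by simpa using hy)⟩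
    have huniq : ∀ i x y, IsTopExcept h X i x → IsTopExcept h X i y → x = y :=
      fun i x y hx hy => hinj i (le_antisymm (hy.2 x hx.1) (hx.2 y hy.1))
    rw [bipartiteAbove, hrooms, card_extensions_eq h X n hXc]
    obtain ⟨a, b, -, hiff, hdisj⟩ := hXdom.exists_extensions hinj ⟨z, hzX⟩ hXc
    obtain ⟨x, hx⟩ := htop a
    obtain ⟨y, hy⟩ := htop b
    have : ({x | x ∉ X ∧ IsDominant h (insert x X)} : Finset V) = {x, y} := by
      ext w
      simp only [mem_filter, mem_univ, true_and, mem_insert, mem_singleton]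
      rw [hiff]
      constructor
      · exact Or.imp (fun hw => huniq a w x hw hx) (fun hw => huniq b w y hw hy)
      · rintro (rfl | rfl)
        exacts [Or.inl hx, Or.inr hy]
    rw [this, card_pair]
    · exact even_two
    · rintro rfl
      exact hdisj x ⟨hx, hy⟩
  have hcount := sum_card_bipartiteAbove_eq_sum_card_bipartiteBelow (s := doors) (t := rooms)
    (fun X Y : Finset V => X ⊆ Y)
  have h2 := even_sum _ hEvenRooms
  rw [← hcount, ← add_sum_erase _ _ hX₀door, hOne] at h2
  have h3 := even_sum _ hEvenDoors
  rw [Nat.even_add] at h2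
  exact absurd (h2.2 h3) (by decide)

end Dominant

/-- The version of `exists_isDominant_colorful` without corners, for orders with ties. -/
theorem exists_weaklyDominant_colorful {I T : Type*} [Fintype I] [Nontrivial I] [Fintype T]
    [Nonempty T] (g : I → T → ℕ) (c : T → I) :
    ∃ (X : Set T) (C : Set I), (∀ y, ∃ i ∈ C, ∀ x ∈ X, g i y ≤ g i x) ∧
      ∀ i ∈ C, ∃ x ∈ X, c x = i := by
  classical
  let e := Fintype.equivFin T
  let e' := Fintype.equivFin I
  -- In order `i`, corner `i` is on level 0, the points of `T` on level 1 and the other corners on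
  -- level 2; the enumerations break ties.
  let h : I → T ⊕ I → ℕ ×ₗ (ℕ ×ₗ ℕ) := fun i => Sum.elim
    (fun x => toLex (1, toLex (g i x, (e x : ℕ))))
    (fun j => toLex (if j = i then 0 else 2, toLex (0, (e' j : ℕ))))
  have hinj : ∀ i, Function.Injective (h i) := by
    rintro i (x | j) (y | k) hxy
    · simp only [h, Sum.elim_inl, EmbeddingLike.apply_eq_iff_eq, Prod.mk.injEq] at hxy
      rw [e.injective (Fin.ext hxy.2.2)]
    · simp only [h, Sum.elim_inl, Sum.elim_inr, EmbeddingLike.apply_eq_iff_eq,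
        Prod.mk.injEq] at hxy
      split_ifs at hxy <;> simp at hxy
    · simp only [h, Sum.elim_inl, Sum.elim_inr, EmbeddingLike.apply_eq_iff_eq,
        Prod.mk.injEq] at hxy
      split_ifs at hxy <;> simp at hxy
    · simp only [h, Sum.elim_inr, EmbeddingLike.apply_eq_iff_eq, Prod.mk.injEq] at hxy
      rw [e'.injective (Fin.ext hxy.2.2)]
  have hlt : ∀ i x, h i (Sum.inr i) < h i (Sum.inl x) := by
    intro i x
    simp [h, Prod.Lex.toLex_lt_toLex]
  obtain ⟨X, hX, hcol⟩ := exists_isDominant_colorful hinj Sum.inr (Sum.elim c id)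
    (fun i => rfl) (by
      rintro i (x | j)
      · exact (hlt i x).le
      · by_cases hij : j = i
        · rw [hij]
        · simp [h, Prod.Lex.toLex_le_toLex, hij])
    (by
      rintro i j (x | k) hji hx
      · simp [h, Prod.Lex.toLex_lt_toLex, hji]
      · exact absurd ⟨k, rfl⟩ hx)
    (by
      obtain ⟨x⟩ := (inferInstance : Nonempty T)
      exact ⟨Sum.inl x, by simp⟩)
  -- `C` consists of the indices whose corner is missing from `X`: a corner `i` in `X` lies below
  -- all of `T` in order `i`, so that order cannot serve any `y`.
  refine ⟨{x | Sum.inl x ∈ X}, {i | Sum.inr i ∉ X}, fun y => ?_, fun i hi => ?_⟩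
  · obtain ⟨i, hi⟩ := hX (Sum.inl y)
    refine ⟨i, fun hiX => absurd (hi _ hiX) (not_le.2 (hlt i y)), fun x hx => ?_⟩
    have := hi _ hx
    simp only [h, Sum.elim_inl, Prod.Lex.toLex_le_toLex, lt_self_iff_false, true_and,
      false_or] at this
    rcases this with h1 | h1
    · exact h1.le
    · exact h1.1.le
  · obtain ⟨x | j, hx, hxi⟩ := hcol i
    · exact ⟨x, hx, hxi⟩
    · exact absurd (show Sum.inr i ∈ X from (show j = i from hxi) ▸ hx) hi

/-! ### From the integer grid to the KKM theorem. -/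

/-- In a coloured grid of a simplex there are nearby points of all the colours of a face close to
them. -/
theorem exists_grid_colorful {n : ℕ} (hn : 2 ≤ n) (M : ℕ) (c : (Fin n → ℕ) → Fin n) :
    ∃ (X : Set (Fin n → ℕ)) (C : Set (Fin n)), X.Nonempty ∧ C.Nonempty ∧
      (∀ x ∈ X, ∑ i, x i = M) ∧ (∀ i ∈ C, ∃ x ∈ X, c x = i) ∧
      (∀ x ∈ X, ∀ y ∈ X, ∀ i, x i ≤ y i + n) ∧ ∀ i ∉ C, ∀ x ∈ X, x i ≤ n := by
  classical
  have : Nontrivial (Fin n) := Fin.nontrivial_iff_two_le.2 hn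
  have hmem : ∀ x : Fin n → ℕ, x ∈ piAntidiag (univ : Finset (Fin n)) M ↔ ∑ i, x i = M :=
    fun x => by simp
  let T := piAntidiag (univ : Finset (Fin n)) M
  have y₀ : T := ⟨Pi.single ⟨0, by omega⟩ M, by rw [hmem]; simp⟩
  have : Nonempty T := ⟨y₀⟩
  obtain ⟨X, C, hdom, hcol⟩ := exists_weaklyDominant_colorful (fun i (x : T) => x.1 i)
    (fun x => c x.1)
  obtain ⟨j, hj, -⟩ := hdom y₀
  obtain ⟨x₀, hx₀, -⟩ := hcol j hj
  have hsum : ∀ x : T, ∑ i, x.1 i = M := fun x => (hmem _).1 x.2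
  choose m hmX hmin using fun i : Fin n =>
    exists_min_image (univ.filter (· ∈ X)) (fun x : T => x.1 i) ⟨x₀, by simpa using hx₀⟩
  have hmin : ∀ i, ∀ x ∈ X, (m i).1 i ≤ x.1 i := fun i x hx => hmin i x (by simpa using hx)
  have hmX : ∀ i, m i ∈ X := fun i => by simpa using hmX i
  -- Otherwise some grid point exceeds the minima of `X` in all coordinates of `C`, against
  -- dominance. So the minima over `C` use up all of `M` but less than `n`, which bounds both the
  -- spread inside `C` and the coordinates outside it.
  have hbig : M < ∑ i ∈ univ.filter (· ∈ C), ((m i).1 i + 1) := by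
    by_contra! hle
    set S := ∑ i ∈ univ.filter (· ∈ C), ((m i).1 i + 1) with hS
    let y : Fin n → ℕ := (fun i => if i ∈ C then (m i).1 i + 1 else 0) + Pi.single j (M - S)
    have hy : ∑ i, y i = M := by
      simp only [y, Pi.add_apply, sum_add_distrib, ← sum_filter, ← hS]
      simp
      omega
    obtain ⟨i, hi, hiy⟩ := hdom ⟨y, (hmem y).2 hy⟩
    have := hiy (m i) (hmX i)
    simp only [y, Pi.add_apply, hi, if_true] at this
    omega
  have hC : #(univ.filter (· ∈ C)) ≤ n := (card_filter_le _ _).trans (by simp)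
  rw [sum_add_distrib, sum_const, smul_eq_mul, mul_one] at hbig
  have hsplit : ∀ x : T, ∑ i ∈ univ.filter (· ∈ C), x.1 i + ∑ i ∈ univ.filter (· ∉ C), x.1 i = M :=
    fun x => by rw [sum_filter_add_sum_filter_not, hsum]
  have hout : ∀ i ∉ C, ∀ x ∈ X, x.1 i ≤ n := by
    intro i hi x hx
    have h1 : x.1 i ≤ ∑ i ∈ univ.filter (· ∉ C), x.1 i :=
      single_le_sum (f := fun i => x.1 i) (fun _ _ => Nat.zero_le _) (by simpa using hi)
    have h2 : ∑ i ∈ univ.filter (· ∈ C), (m i).1 i ≤ ∑ i ∈ univ.filter (· ∈ C), x.1 i :=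
      sum_le_sum fun i _ => hmin i x hx
    have := hsplit x
    omega
  have hin : ∀ i ∈ C, ∀ x ∈ X, x.1 i ≤ (m i).1 i + n := by
    intro i hi x hx
    have hi' : i ∈ univ.filter (· ∈ C) := by simpa using hi
    have h1 := hsplit x
    rw [← add_sum_erase _ _ hi'] at h1 hbig
    have h2 : ∑ i ∈ (univ.filter (· ∈ C)).erase i, (m i).1 i ≤
        ∑ i ∈ (univ.filter (· ∈ C)).erase i, x.1 i :=
      sum_le_sum fun i _ => hmin i x hx
    omega
  refine ⟨Subtype.val '' X, C, ⟨_, x₀, hx₀, rfl⟩, ⟨j, hj⟩, ?_, ?_, ?_, ?_⟩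
  · rintro _ ⟨x, -, rfl⟩
    exact hsum x
  · intro i hi
    obtain ⟨x, hx, hxi⟩ := hcol i hi
    exact ⟨x.1, ⟨x, hx, rfl⟩, hxi⟩
  · rintro _ ⟨x, hx, rfl⟩ _ ⟨y, hy, rfl⟩ i
    by_cases hi : i ∈ C
    · have h1 := hin i hi x hx
      have h2 := hmin i y hy
      omega
    · have := hout i hi x hx
      omega
  · rintro i hi _ ⟨x, hx, rfl⟩
    exact hout i hi x hx

instance RentDivision.instCompactSpace {n : ℕ} {R : ℝ} : CompactSpace (RentDivision n R) := by
  have hsub : {p : Fin n → ℝ | (∀ r, 0 ≤ p r) ∧ ∑ r, p r = R} ⊆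
      Set.Icc (fun _ => 0) (fun _ => R) := fun p hp =>
    ⟨hp.1, fun r => hp.2 ▸ single_le_sum (fun s _ => hp.1 s) (mem_univ r)⟩
  have hclosed : IsClosed {p : Fin n → ℝ | (∀ r, 0 ≤ p r) ∧ ∑ r, p r = R} := by
    refine IsClosed.and ?_ (isClosed_eq (by fun_prop) continuous_const)
    simp only [Set.ofPred_forall]
    exact isClosed_iInter fun r => isClosed_le continuous_const (continuous_apply r)
  exact isCompact_iff_compactSpace.1 (isCompact_Icc.of_isClosed_subset hclosed hsub)

/-- The Knaster–Kuratowski–Mazurkiewicz theorem, in its version for closed sets that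
cover the facets: closed sets that cover the simplex, the `r`-th one containing the facet opposite
to the `r`-th vertex, have a common point. -/
theorem exists_mem_iInter_of_facets_subset {n : ℕ} (hn : 2 ≤ n) {R : ℝ} (hR : 0 < R)
    (F : Fin n → Set (RentDivision n R)) (hF : ∀ r, IsClosed (F r))
    (hfacet : ∀ r (p : RentDivision n R), p.1 r = 0 → p ∈ F r) (hcover : ∀ p, ∃ r, p ∈ F r) :
    ∃ p, ∀ r, p ∈ F r := by
  let pt : ℕ → (Fin n → ℕ) → Fin n → ℝ := fun M x r => R * x r / (M + 1 : ℕ)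
  have hpt : ∀ M x, ∑ r, x r = M + 1 → (∀ r, 0 ≤ pt M x r) ∧ ∑ r, pt M x r = R := by
    intro M x hx
    refine ⟨fun r => by positivity, ?_⟩
    simp only [pt]
    rw [← sum_div, ← mul_sum, ← Nat.cast_sum, hx]
    field_simp
  have step : ∀ M : ℕ, ∃ p : RentDivision n R, ∀ r, ∃ q ∈ F r,
      dist p q ≤ R * n / (M + 1 : ℕ) := by
    intro M
    choose col hcol using hcover
    obtain ⟨X, C, ⟨x, hx⟩, ⟨j, hj⟩, hsum, hX, hclose, hout⟩ :=
      exists_grid_colorful hn (M + 1) fun x =>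
        if h : ∑ r, x r = M + 1 then col ⟨pt M x, hpt M x h⟩ else ⟨0, by omega⟩
    refine ⟨⟨pt M x, hpt M x (hsum x hx)⟩, fun r => ?_⟩
    by_cases hr : r ∈ C
    · obtain ⟨y, hy, hyr⟩ := hX r hr
      rw [dif_pos (hsum y hy)] at hyr
      refine ⟨⟨pt M y, hpt M y (hsum y hy)⟩, hyr ▸ hcol _, ?_⟩
      rw [Subtype.dist_eq, dist_pi_le_iff (by positivity)]
      intro s
      have h1 : (x s : ℝ) ≤ y s + n := by exact_mod_cast hclose x hx y hy s
      have h2 : (y s : ℝ) ≤ x s + n := by exact_mod_cast hclose y hy x hx s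
      have h3 : pt M x s - pt M y s = R * (x s - y s : ℝ) / (M + 1 : ℕ) := by
        simp only [pt]
        ring
      rw [Real.dist_eq, h3, abs_div, abs_mul, abs_of_pos hR, Nat.abs_cast]
      gcongr
      rw [abs_le]
      constructor <;> linarith
    · have hjr : j ≠ r := fun h => hr (h ▸ hj)
      -- Coordinate `r` is at most `n`, so moving it to `j` reaches the facet of `r`, hence `F r`,
      -- at a small distance.
      let y : Fin n → ℕ := Function.update x r 0 + Pi.single j (x r)
      have hy : ∑ s, y s = M + 1 := by
        simp only [y, Pi.add_apply, sum_add_distrib]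
        rw [sum_update_of_mem (mem_univ r), sum_pi_single', if_pos (mem_univ _), zero_add,
          ← hsum x hx, sdiff_singleton_eq_erase, sum_erase_add _ _ (mem_univ r)]
      refine ⟨⟨pt M y, hpt M y hy⟩, hfacet r _ ?_, ?_⟩
      · simp [pt, y, hjr]
      · rw [Subtype.dist_eq, dist_pi_le_iff (by positivity)]
        intro s
        have h0 : (x r : ℝ) ≤ n := by exact_mod_cast hout r hr x hx
        have h3 : pt M x s - pt M y s = R * (x s - y s : ℝ) / (M + 1 : ℕ) := by
          simp only [pt]
          ring
        rw [Real.dist_eq, h3, abs_div, abs_mul, abs_of_pos hR, Nat.abs_cast]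
        gcongr
        by_cases hsr : s = r
        · subst hsr
          simpa [y, hjr.symm] using h0
        · by_cases hsj : s = j
          · subst hsj
            simpa [y, hsr] using h0
          · simp [y, hsr, hsj]
  choose p q hqF hpq using step
  obtain ⟨a, -, φ, hφ, ha⟩ := isCompact_univ.tendsto_subseq fun M => Set.mem_univ (p M)
  refine ⟨a, fun r => (hF r).mem_of_tendsto (b := atTop) (f := fun k => q (φ k) r) ?_
    (Eventually.of_forall fun k => hqF (φ k) r)⟩
  refine ha.congr_dist ?_
  have hlim : Tendsto (fun M : ℕ => R * n / ((M + 1 : ℕ) : ℝ)) atTop (𝓝 0) :=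
    ((tendsto_const_div_atTop_nhds_zero_nat (R * n)).comp (tendsto_add_atTop_nat 1))
  exact squeeze_zero (fun _ => dist_nonneg) (fun k => hpq (φ k) r) (hlim.comp hφ.tendsto_atTop)

/-! ### Weights, matchings and the colourful Sperner lemma. -/

/-- Finitely many continuous weight functions, each of them concentrated near a division of
the rent and vanishing where a room not free in that division is free. -/
theorem exists_weights (n : ℕ) {R : ℝ} (hR : 0 < R) {ε : ℝ} (hε : 0 < ε) :
    ∃ (Q : Finset (RentDivision n R)) (w : RentDivision n R → RentDivision n R → ℝ),
      (∀ v, Continuous (w v)) ∧ (∀ v x, 0 ≤ w v x) ∧ (∀ x, ∃ v ∈ Q, 0 < w v x) ∧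
      ∀ v x, 0 < w v x → (∀ s, |v.1 s - x.1 s| ≤ ε) ∧ ∀ r, x.1 r = 0 → v.1 r = 0 := by
  -- A positive weight forces `v r - x r ≤ δ * R` for every `r`; since both price vectors sum to
  -- `R`, also `x s - v s ≤ n * (δ * R)`. The choice of `δ` makes `(n + 1) * (δ * R) = ε`.
  set δ : ℝ := ε / ((n + 1) * R) with hδ
  have hδ0 : 0 < δ := by positivity
  let w : RentDivision n R → RentDivision n R → ℝ := fun v x =>
    ∏ r, if v.1 r = 0 then 1 else max 0 ((1 + δ) * x.1 r - v.1 r)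
  have hle : ∀ (x : RentDivision n R) r, x.1 r ≤ R := fun x r => by
    conv_rhs => rw [← x.2.2]
    exact single_le_sum (fun s _ => x.2.1 s) (mem_univ r)
  have hcont : ∀ v, Continuous (w v) := by
    intro v
    refine continuous_finsetProd _ fun r _ => ?_
    split_ifs
    · exact continuous_const
    · have : Continuous fun x : RentDivision n R => x.1 r :=
        (continuous_apply r).comp continuous_subtype_val
      exact continuous_const.max ((continuous_const.mul this).sub continuous_const)
  have hnn : ∀ v x, 0 ≤ w v x := by
    intro v x
    refine prod_nonneg fun r _ => ?_
    split_ifs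
    · exact zero_le_one
    · exact le_max_left _ _
  have hself : ∀ v, 0 < w v v := by
    intro v
    refine prod_pos fun r _ => ?_
    split_ifs with h
    · exact one_pos
    · have : 0 < v.1 r := lt_of_le_of_ne (v.2.1 r) (Ne.symm h)
      refine lt_max_of_lt_right ?_
      have := mul_pos hδ0 this
      linarith
  have hpos : ∀ v x, 0 < w v x → ∀ r, v.1 r ≠ 0 → v.1 r < (1 + δ) * x.1 r := by
    intro v x hw r hr
    by_contra! hcon
    refine hw.ne' (prod_eq_zero (mem_univ r) ?_)
    rw [if_neg hr, max_eq_left (by linarith)]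
  obtain ⟨Q, -, hQ⟩ := isCompact_univ.elim_nhds_subcover (fun v => {x | 0 < w v x}) fun v _ =>
    (isOpen_lt continuous_const (hcont v)).mem_nhds (hself v)
  refine ⟨Q, w, hcont, hnn, fun x => ?_, fun v x hw => ⟨fun s => ?_, fun r hr => ?_⟩⟩
  · have := hQ (Set.mem_univ x)
    simpa using this
  · have hup : ∀ r, v.1 r - x.1 r ≤ δ * R := by
      intro r
      have h1 := mul_le_mul_of_nonneg_left (hle x r) hδ0.le
      by_cases hr : v.1 r = 0
      · have := x.2.1 r
        have : 0 < δ * R := by positivity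
        linarith
      · have := hpos v x hw r hr
        linarith
    have hδR : (n + 1) * (δ * R) = ε := by
      rw [hδ]
      field_simp
    have hδR0 : 0 < δ * R := by positivity
    have hn0 : (0 : ℝ) ≤ n := Nat.cast_nonneg n
    have hlow : x.1 s - v.1 s ≤ n * (δ * R) := by
      have h0 : ∑ r, (δ * R - (v.1 r - x.1 r)) = n * (δ * R) := by
        simp [sum_sub_distrib, v.2.2, x.2.2]
      have h1 := single_le_sum (f := fun r => δ * R - (v.1 r - x.1 r))
        (fun r _ => sub_nonneg.2 (hup r)) (mem_univ s)
      rw [h0] at h1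
      linarith
    rw [abs_le]
    have := hup s
    constructor <;> nlinarith
  · by_contra hv
    have := hpos v x hw r hv
    have := v.2.1 r
    rw [hr, mul_zero] at *
    linarith

/-- If all the row sums of a nonnegative matrix are equal, and larger than the column sums,
then every column can be avoided by a matching of the rows with columns along positive entries. -/
theorem exists_injective_avoiding {ι κ : Type*} [Fintype ι] [Fintype κ]
    {a : ι → κ → ℝ} (ha : ∀ i r, 0 ≤ a i r) {W : ℝ} (hrow : ∀ i, ∑ r, a i r = W)
    (hcol : ∀ r, ∑ i, a i r < W) (c : κ) :
    ∃ f : ι → κ, Function.Injective f ∧ ∀ i, f i ≠ c ∧ 0 < a i (f i) := by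
  classical
  have hW : 0 < W := (sum_nonneg fun i _ => ha i c).trans_lt (hcol c)
  obtain ⟨f, hf, hfm⟩ := (all_card_le_biUnion_card_iff_exists_injective
    (fun i => ({r | 0 < a i r} : Finset κ).erase c)).1 (by
      intro S
      rcases S.eq_empty_or_nonempty with rfl | hS
      · simp
      set N : Finset κ := S.biUnion fun i => {r | 0 < a i r} with hN
      have herase : S.biUnion (fun i => ({r | 0 < a i r} : Finset κ).erase c) = N.erase c := by
        ext r
        simp only [hN, mem_biUnion, mem_erase]
        tauto
      rw [herase]
      -- All the weight of the rows in `S` sits in the columns of `N`, each holding less than `W`.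
      -- So `N` has more elements than `S` and can spare `c`.
      have hsum : #S * W = ∑ r ∈ N, ∑ i ∈ S, a i r := by
        rw [sum_comm, ← nsmul_eq_mul, ← sum_const]
        refine sum_congr rfl fun i hi => ?_
        rw [← hrow i]
        symm
        refine sum_subset (subset_univ N) fun r _ hr => le_antisymm ?_ (ha i r)
        by_contra! h
        exact hr (mem_biUnion.2 ⟨i, hi, by simpa using h⟩)
      have hNne : N.Nonempty := by
        by_contra hemp
        rw [not_nonempty_iff_eq_empty.1 hemp, sum_empty] at hsum
        have : (0 : ℝ) < #S := by exact_mod_cast hS.card_pos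
        exact (mul_pos this hW).ne' hsum
      have hlt : #S * W < #N * W := by
        rw [hsum, ← nsmul_eq_mul, ← sum_const]
        refine sum_lt_sum_of_nonempty hNne fun r _ => ?_
        exact (sum_le_univ_sum_of_nonneg fun i => ha i r).trans_lt (hcol r)
      have hlt' : #S < #N := by exact_mod_cast lt_of_mul_lt_mul_right hlt hW.le
      have := pred_card_le_card_erase (s := N) (a := c)
      omega)
  refine ⟨f, hf, fun i => ?_⟩
  have := hfm i
  simp only [mem_erase, mem_filter, mem_univ, true_and] at this
  exact this

/-- A colourful version of Sperner's lemma for one labelling less than there are labels: some point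
has, for every label `c`, nearby points with distinct labels other than `c`. -/
theorem exists_sperner_avoiding {n : ℕ} (hn : 2 ≤ n) {R : ℝ} (hR : 0 < R) {ε : ℝ} (hε : 0 < ε) :
    ∃ Q : Finset (RentDivision n R), ∀ m : Fin (n - 1) → RentDivision n R → Fin n,
      (∀ i (v : RentDivision n R), v.1 (m i v) ≠ 0) →
        ∃ p : RentDivision n R, ∀ c, ∃ f : Fin (n - 1) → Fin n, Function.Injective f ∧ ∀ i, f i ≠ c ∧
          ∃ v ∈ Q, (∀ s, |v.1 s - p.1 s| ≤ ε) ∧ m i v = f i := by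
  obtain ⟨Q, w, hcont, hnn, hcov, hw⟩ := exists_weights n hR hε
  refine ⟨Q, fun m hm => ?_⟩
  let a : RentDivision n R → Fin (n - 1) → Fin n → ℝ := fun p i r => ∑ v ∈ Q with m i v = r, w v p
  let W : RentDivision n R → ℝ := fun p => ∑ v ∈ Q, w v p
  have hrow : ∀ p i, ∑ r, a p i r = W p := fun p i => sum_fiberwise Q (m i) fun v => w v p
  have hWpos : ∀ p, 0 < W p := by
    intro p
    obtain ⟨v, hv, hvp⟩ := hcov p
    exact sum_pos' (fun v _ => hnn v p) ⟨v, hv, hvp⟩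
  have hn1 : ((n - 1 : ℕ) : ℝ) = n - 1 := by
    rw [Nat.cast_sub (by omega), Nat.cast_one]
  have htot : ∀ p, ∑ r, ∑ i, a p i r = (n - 1) * W p := by
    intro p
    rw [sum_comm, sum_congr rfl fun i _ => hrow p i]
    simp [hn1]
  -- The sets ask that a column sum be at most the average `(n - 1) / n * W p`. They cover because
  -- not every column exceeds the average; on the facet of `r`, column `r` vanishes because labels
  -- are non-free rooms.
  obtain ⟨p, hp⟩ := exists_mem_iInter_of_facets_subset hn hR
    (fun r => {p | n * ∑ i, a p i r ≤ (n - 1) * W p})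
    (fun r => isClosed_le
      (continuous_const.mul (continuous_finsetSum _ fun i _ =>
        continuous_finsetSum _ fun v _ => hcont v))
      (continuous_const.mul (continuous_finsetSum _ fun v _ => hcont v)))
    (by
      intro r p hr
      have h0 : ∀ i, a p i r = 0 := by
        intro i
        refine sum_eq_zero fun v hv => ?_
        rw [mem_filter] at hv
        refine le_antisymm ?_ (hnn v p)
        by_contra! hvp
        exact hm i v (hv.2 ▸ (hw v p hvp).2 r hr)
      simp only [Set.mem_ofPred_eq, h0, sum_const_zero, mul_zero]
      refine mul_nonneg ?_ (hWpos p).le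
      rw [← hn1]
      positivity)
    (by
      intro p
      by_contra! hcon
      simp only [Set.mem_ofPred_eq, not_le] at hcon
      have : ∑ r : Fin n, (n - 1) * W p < ∑ r, n * ∑ i, a p i r :=
        sum_lt_sum_of_nonempty ⟨⟨0, by omega⟩, mem_univ _⟩ fun r _ => hcon r
      rw [sum_const, card_univ, Fintype.card_fin, nsmul_eq_mul, ← mul_sum, htot] at this
      exact lt_irrefl _ this)
  refine ⟨p, fun c => ?_⟩
  obtain ⟨f, hf, hfa⟩ := exists_injective_avoiding (a := a p) (W := W p)
    (fun i r => sum_nonneg fun v _ => hnn v p) (hrow p) (fun r => by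
      have h1 : n * ∑ i, a p i r ≤ (n - 1) * W p := hp r
      have h2 : (0 : ℝ) < n := by exact_mod_cast (by omega : 0 < n)
      have h3 := hWpos p
      refine lt_of_mul_lt_mul_left (h1.trans_lt ?_) h2.le
      linarith) c
  refine ⟨f, hf, fun i => ⟨(hfa i).1, ?_⟩⟩
  obtain ⟨v, hv, hvp⟩ := exists_lt_of_sum_lt
    (f := fun _ => (0 : ℝ)) (g := fun v => w v p) (by simpa using (hfa i).2)
  rw [mem_filter] at hv
  exact ⟨v, hv.1, (hw v p hvp).1, hv.2⟩

/-! ### Preferences as Sperner labels, and the survey. -/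

/-- In the cyclic order of the rooms, some acceptable room follows a non-free one. Hence the
acceptable rooms, shifted by one, can satisfy the boundary condition of Sperner's lemma. -/
theorem IsAdmissible.exists_nonfree {n : ℕ} [NeZero n] {R : ℝ} (hR : 0 < R)
    {A : Preferences n R} (hA : IsAdmissible A) (p : RentDivision n R) :
    ∃ r : Fin n, p.1 r ≠ 0 ∧ r + 1 ∈ A p := by
  obtain ⟨s, hs⟩ := hA.acceptable p
  by_cases hfree : ∃ r, p.1 r = 0
  · have hall : ∀ r, p.1 r = 0 → r ∈ A p := by
      intro r hr
      rcases (p.2.1 s).eq_or_lt with h | h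
      · exact (hA.indifferent p r s hr h.symm).2 hs
      · exact hA.free_over_nonfree p r s hr h hs
    -- All free rooms are acceptable here. If none of them followed a non-free room, freeness would
    -- spread backwards round the cycle and the total rent would be zero.
    by_contra! hcon
    have hstep : ∀ r, p.1 (r + 1) = 0 → p.1 r = 0 := by
      intro r hr
      by_contra h
      exact hcon r h (hall _ hr)
    obtain ⟨r, hr⟩ := hfree
    have hback : ∀ k : ℕ, p.1 (r - (Fin.ofNat n k)) = 0 := by
      intro k
      induction k with
      | zero => simpa using hr
      | succ k ih =>
        apply hstep
        convert ih using 2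
        have : Fin.ofNat n (k + 1) = Fin.ofNat n k + 1 := by
          ext
          simp [Fin.val_add]
        rw [this, sub_add_eq_sub_sub, sub_add_cancel]
    have hzero : ∀ s, p.1 s = 0 := by
      intro s
      have := hback (r - s).val
      simpa using this
    have := p.2.2
    simp only [hzero, sum_const_zero] at this
    exact hR.ne this
  · push Not at hfree
    exact ⟨s - 1, hfree _, by simpa using hs⟩

theorem theorem1 (n : ℕ) (hn : 1 ≤ n) (R : ℝ) (hR : 0 < R) (ε : ℝ) (hε : 0 < ε) :
    ∃ (Q : Finset (RentDivision n R))
      (find : Survey Q → RentDivision n R)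
      (assign : Survey Q → (c : Fin n) → (Fin (n - 1) ≃ {r : Fin n // r ≠ c})),
      ∀ A : Fin (n - 1) → Preferences n R, (∀ i, IsAdmissible (A i)) →
        ∀ (c : Fin n) (i : Fin (n - 1)),
          ContentWithin ε (A i) (find (surveyOf Q A)) (assign (surveyOf Q A) c i).1 := by
  classical
  have : NeZero n := ⟨by omega⟩
  have hcard : ∀ c : Fin n, Fintype.card (Fin (n - 1)) = Fintype.card {r : Fin n // r ≠ c} := by
    intro c
    simp
  have p₀ : RentDivision n R := ⟨Pi.single 0 R, fun r => by
    by_cases h : r = 0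
    · subst h
      simpa using hR.le
    · simp [h], by simp⟩
  have hpos : ∀ v : RentDivision n R, ∃ r, v.1 r ≠ 0 := by
    intro v
    by_contra! h
    exact hR.ne (by simpa [h] using v.2.2)
  -- Quantifying over surveys, not preferences, ensures that the chosen prices and assignments
  -- depend on the answers alone.
  obtain ⟨Q, hQ⟩ : ∃ Q : Finset (RentDivision n R),
      ∀ S : Survey Q, ∃ (p : RentDivision n R)
        (σ : ∀ c : Fin n, Fin (n - 1) ≃ {r : Fin n // r ≠ c}),
        (∀ i (v : Q), ∃ r : Fin n, v.1.1 r ≠ 0 ∧ r + 1 ∈ S i v) →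
        ∀ c i, ∃ v : Q, (∀ s, |v.1.1 s - p.1 s| ≤ ε) ∧ (σ c i).1 ∈ S i v := by
    rcases hn.eq_or_lt with rfl | hn2
    · exact ⟨∅, fun S => ⟨p₀, fun c => Fintype.equivOfCardEq (hcard c), fun _ c i => i.elim0⟩⟩
    obtain ⟨Q, hQ⟩ := exists_sperner_avoiding hn2 hR hε
    refine ⟨Q, fun S => ?_⟩
    by_cases hS : ∀ i (v : Q), ∃ r : Fin n, v.1.1 r ≠ 0 ∧ r + 1 ∈ S i v
    · choose m hm hmS using hS
      choose m₀ hm₀ using hpos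
      -- Labels off `Q` are never consulted; `m₀` only keeps the boundary condition.
      obtain ⟨p, hp⟩ := hQ (fun i v => if hv : v ∈ Q then m i ⟨v, hv⟩ else m₀ v) (by
        intro i v
        split_ifs with hv
        · exact hm i ⟨v, hv⟩
        · exact hm₀ v)
      choose f hf hfc using hp
      -- Labels are rooms shifted back by one: avoiding the label `c - 1` and shifting forward
      -- avoids the room `c`.
      let g : ∀ c : Fin n, Fin (n - 1) → {r : Fin n // r ≠ c} := fun c i =>
        ⟨f (c - 1) i + 1, fun h => (hfc (c - 1) i).1 (eq_sub_of_add_eq h)⟩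
      have hg : ∀ c, Function.Bijective (g c) := by
        intro c
        rw [Fintype.bijective_iff_injective_and_card]
        refine ⟨fun i j hij => hf (c - 1) ?_, hcard c⟩
        simpa [g] using hij
      refine ⟨p, fun c => Equiv.ofBijective _ (hg c), fun _ c i => ?_⟩
      obtain ⟨v, hv, hvp, hvm⟩ := (hfc (c - 1) i).2
      rw [dif_pos hv] at hvm
      refine ⟨⟨v, hv⟩, hvp, ?_⟩
      have := hmS i ⟨v, hv⟩
      rwa [hvm] at this
    · exact ⟨p₀, fun c => Fintype.equivOfCardEq (hcard c), fun h => absurd h hS⟩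
  choose find assign hfa using hQ
  refine ⟨Q, find, assign, fun A hA c i => ?_⟩
  obtain ⟨v, hv, hvA⟩ := hfa (surveyOf Q A)
    (fun i v => (hA i).exists_nonfree hR v.1) c i
  exact ⟨v.1, hv, hvA⟩
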